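/- Let $F$ be a field of characteristic different from $2$ and $3$. A (right) Jordan dialgebra over $F$ is an $F$-vector space $D$ with a bilinear product $ab$ satisfying $$a(bc)=a(cb),\qquad (a,b,c^2)=2(ac,b,c),\qquad (ba^2)a=(ba)a^2$$ for all $a,b,c\in D$, where $(x,y,z)=(xy)z-x(yz)$. On such a $D$ consider the two trilinear operations $$\langle a,b,c\rangle_1=(ab)c-(ac)b+a(bc),\qquad \langle a,b,c\rangle_2=(ba)c+(bc)a-b(ac).$$ A polynomial identity satisfied by $\langle\cdot\rangle_1,\langle\cdot\rangle_2$ in a Jordan dialgebra is an identity $f\equiv 0$ which holds for these operations in every Jordan dialgebra over $F$, where $f$ is an element of the free nonassociative $F$-algebra with two trilinear operations on countably many generators; it has degree $5$ if $f$ is homogeneous of degree $5$ ($f$ need not be multilinear). An identity is a consequence of a set of identities if it holds in every $F$-vector space with two trilinear operations in which all the identities of the set hold. Then $\langle\cdot\rangle_1,\langle\cdot\rangle_2$ satisfy the symmetry $\langle a,b,c\rangle_2\equiv\langle c,b,a\rangle_2$ and the following seven identities in every Jordan dialgebra over $F$; every polynomial identity of degree $5$ satisfied by $\langle\cdot\rangle_1,\langle\cdot\rangle_2$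 in a Jordan dialgebra is a consequence of the symmetry together with these seven identities; and the seven are independent, that is, none of them is a consequence of the symmetry and the other six: \begin{align*} &\langle a,\langle b,c,d\rangle_1,e\rangle_1-\langle a,\langle d,c,b\rangle_2,e\rangle_1\equiv 0,\\ &\langle a,b,\langle c,d,e\rangle_1\rangle_1-\langle a,b,\langle e,d,c\rangle_2\rangle_1\equiv 0,\\ &\langle\langle a,b,c\rangle_1,d,e\rangle_2-\langle\langle c,b,a\rangle_2,d,e\rangle_2\equiv 0,\\ &\langle\langle a,b,c\rangle_2,d,e\rangle_1-\langle\langle e,d,a\rangle_2,b,c\rangle_2+\langle a,\langle b,e,d\rangle_1,c\rangle_2-\langle\langle e,d,c\rangle_2,b,a\rangle_2\equiv 0,\\ &\langle\langle a,b,c\rangle_2,d,e\rangle_1-\langle a,\langle b,c,d\rangle_1,e\rangle_2-\langle e,\langle b,a,d\rangle_1,c\rangle_2+\langle\langle a,d,c\rangle_2,b,e\rangle_2\equiv 0,\\ &\langle\langle a,b,c\rangle_1,d,e\rangle_1+\langle\langle a,b,e\rangle_1,d,c\rangle_1-\langle a,b,\langle c,d,e\rangle_2\rangle_1-\langle c,\langle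 d,a,b\rangle_2,e\rangle_2\equiv 0,\\ &\langle\langle a,b,c\rangle_1,d,e\rangle_1+\langle\langle a,d,c\rangle_1,b,e\rangle_1-\langle a,\langle b,c,d\rangle_2,e\rangle_1-\langle e,\langle b,a,d\rangle_2,c\rangle_2\equiv 0. \end{align*} -/

import Mathlib

universe u

namespace JordanDialgebra

/-- A right Jordan dialgebra: a vector space with a bilinear product (over a field of characteristic
not 2 or 3) satisfying right commutativity, the Osborn identity `(a,b,c²) = 2(ac,b,c)` and the right
Jordan identity `(ba²)a = (ba)a²`.  Bilinearity is expressed by the classes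
`NonUnitalNonAssocRing`, `Module`, `IsScalarTower`, `SMulCommClass`; `associator x y z` is
`(xy)z - x(yz)`. -/
class IsJordanDialgebra (D : Type*) [NonUnitalNonAssocRing D] : Prop where
  right_comm : ∀ a b c : D, a * (b * c) = a * (c * b)
  osborn : ∀ a b c : D, associator a b (c * c) = 2 • associator (a * c) b c
  right_jordan : ∀ a b : D, (b * (a * a)) * a = (b * a) * (a * a)

/-- A pair of trilinear operations on an `F`-vector space `T`. -/
structure TernaryPair (F T : Type*) [Field F] [AddCommGroup T] [Module F T] where
  op1 : T →ₗ[F] T →ₗ[F] T →ₗ[F] T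
  op2 : T →ₗ[F] T →ₗ[F] T →ₗ[F] T

/-- A function of three variables that is linear in each of them, as a trilinear map. -/
def mkTrilinear {F T : Type*} [Field F] [AddCommGroup T] [Module F T] (f : T → T → T → T)
    (add₁ : ∀ a a' b c, f (a + a') b c = f a b c + f a' b c)
    (smul₁ : ∀ (r : F) a b c, f (r • a) b c = r • f a b c)
    (add₂ : ∀ a b b' c, f a (b + b') c = f a b c + f a b' c)
    (smul₂ : ∀ (r : F) a b c, f a (r • b) c = r • f a b c)
    (add₃ : ∀ a b c c', f a b (c + c') = f a b c + f a b c')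
    (smul₃ : ∀ (r : F) a b c, f a b (r • c) = r • f a b c) :
    T →ₗ[F] T →ₗ[F] T →ₗ[F] T :=
  LinearMap.mk₂ F
    (fun a b => { toFun := f a b, map_add' := add₃ a b, map_smul' := fun r c => smul₃ r a b c })
    (fun a a' b => LinearMap.ext fun c => add₁ a a' b c)
    (fun r a b => LinearMap.ext fun c => smul₁ r a b c)
    (fun a b b' => LinearMap.ext fun c => add₂ a b b' c)
    (fun r a b => LinearMap.ext fun c => smul₂ r a b c)

/-- The two trilinear operations of a bilinear product:
`⟨a,b,c⟩₁ = (ab)c - (ac)b + a(bc)` and `⟨a,b,c⟩₂ = (ba)c + (bc)a - b(ac)`. -/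
def tripleProducts (F D : Type*) [Field F] [NonUnitalNonAssocRing D] [Module F D]
    [IsScalarTower F D D] [SMulCommClass F D D] : TernaryPair F D where
  op1 := mkTrilinear (fun a b c => (a * b) * c - (a * c) * b + a * (b * c))
    (by intros; simp only [add_mul]; abel)
    (by intros; simp only [smul_mul_assoc, smul_add, smul_sub])
    (by intros; simp only [add_mul, mul_add]; abel)
    (by intros; simp only [smul_mul_assoc, mul_smul_comm, smul_add, smul_sub])
    (by intros; simp only [add_mul, mul_add]; abel)
    (by intros; simp only [smul_mul_assoc, mul_smul_comm, smul_add, smul_sub])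
  op2 := mkTrilinear (fun a b c => (b * a) * c + (b * c) * a - b * (a * c))
    (by intros; simp only [add_mul, mul_add]; abel)
    (by intros; simp only [smul_mul_assoc, mul_smul_comm, smul_add, smul_sub])
    (by intros; simp only [add_mul]; abel)
    (by intros; simp only [smul_mul_assoc, smul_add, smul_sub])
    (by intros; simp only [add_mul, mul_add]; abel)
    (by intros; simp only [smul_mul_assoc, mul_smul_comm, smul_add, smul_sub])

theorem tripleProducts_op1_apply (F : Type*) {D : Type*} [Field F] [NonUnitalNonAssocRing D]
    [Module F D] [IsScalarTower F D D] [SMulCommClass F D D] (a b c : D) :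
    (tripleProducts F D).op1 a b c = (a * b) * c - (a * c) * b + a * (b * c) := rfl

theorem tripleProducts_op2_apply (F : Type*) {D : Type*} [Field F] [NonUnitalNonAssocRing D]
    [Module F D] [IsScalarTower F D D] [SMulCommClass F D D] (a b c : D) :
    (tripleProducts F D).op2 a b c = (b * a) * c + (b * c) * a - b * (a * c) := rfl

/-- Nonassociative monomials in the variables `x₀, x₁, x₂, …` and two ternary operation symbols. -/
inductive TernaryMonomial : Type
  | var : ℕ → TernaryMonomial
  | op1 : TernaryMonomial → TernaryMonomial → TernaryMonomial → TernaryMonomial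
  | op2 : TernaryMonomial → TernaryMonomial → TernaryMonomial → TernaryMonomial

/-- The degree of a monomial: its number of variables, counted with multiplicity. -/
def TernaryMonomial.degree : TernaryMonomial → ℕ
  | .var _ => 1
  | .op1 s t u => s.degree + t.degree + u.degree
  | .op2 s t u => s.degree + t.degree + u.degree

/-- The value of a monomial in `T` when the operation symbols denote the operations of `P` and each
variable `xₙ` denotes `v n`. -/
def TernaryMonomial.eval {F T : Type*} [Field F] [AddCommGroup T] [Module F T]
    (P : TernaryPair F T) (v : ℕ → T) : TernaryMonomial → T
  | .var n => v n
  | .op1 s t u => P.op1 (s.eval P v) (t.eval P v) (u.eval P v)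
  | .op2 s t u => P.op2 (s.eval P v) (t.eval P v) (u.eval P v)

/-- Elements of the free nonassociative `F`-algebra with two trilinear operations on countably many
generators: formal `F`-linear combinations of monomials. -/
abbrev TernaryPoly (F : Type*) [Field F] : Type _ := TernaryMonomial →₀ F

/-- Every monomial that occurs in `f` has degree `n`. -/
def IsHomogeneous {F : Type*} [Field F] (f : TernaryPoly F) (n : ℕ) : Prop :=
  ∀ m ∈ f.support, m.degree = n

/-- The value of a polynomial at `v`. -/
noncomputable def evalPoly {F T : Type*} [Field F] [AddCommGroup T] [Module F T]
    (P : TernaryPair F T) (v : ℕ → T) (f : TernaryPoly F) : T :=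
  f.sum fun m r => r • m.eval P v

/-- The identity `f ≡ 0` holds for the pair of operations `P`. -/
def Satisfies {F T : Type*} [Field F] [AddCommGroup T] [Module F T]
    (P : TernaryPair F T) (f : TernaryPoly F) : Prop :=
  ∀ v : ℕ → T, evalPoly P v f = 0

/-- `f ≡ 0` is a consequence of the identities in `S`: it holds in every `F`-vector space with two
trilinear operations in which all the identities of `S` hold. -/
def IsConsequence {F : Type u} [Field F] (S : Set (TernaryPoly F)) (f : TernaryPoly F) : Prop :=
  ∀ (T : Type u) [AddCommGroup T] [Module F T] (P : TernaryPair F T),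
    (∀ g ∈ S, Satisfies P g) → Satisfies P f

/-- `f ≡ 0` is an identity satisfied by `⟨·,·,·⟩₁` and `⟨·,·,·⟩₂` in (every) Jordan dialgebra
over `F`. -/
def IsJordanDialgebraIdentity {F : Type u} [Field F] (f : TernaryPoly F) : Prop :=
  ∀ (D : Type u) [NonUnitalNonAssocRing D] [Module F D] [IsScalarTower F D D]
    [SMulCommClass F D D] [IsJordanDialgebra D], Satisfies (tripleProducts F D) f

/-- A monomial as a polynomial. -/
noncomputable def mon (F : Type*) [Field F] (m : TernaryMonomial) : TernaryPoly F := Finsupp.single m 1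

open TernaryMonomial in
/-- `⟨a,b,c⟩₂ - ⟨c,b,a⟩₂`, with `a, b, c = x₀, x₁, x₂`. -/
noncomputable def symmetryIdentity (F : Type*) [Field F] : TernaryPoly F :=
  mon F (op2 (var 0) (var 1) (var 2)) - mon F (op2 (var 2) (var 1) (var 0))

open TernaryMonomial in
/-- The seven identities of degree 5, with `a, b, c, d, e = x₀, x₁, x₂, x₃, x₄`. -/
noncomputable def degreeFiveIdentity (F : Type*) [Field F] : Fin 7 → TernaryPoly F :=
  let a := var 0; let b := var 1; let c := var 2; let d := var 3; let e := var 4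
  ![mon F (op1 a (op1 b c d) e) - mon F (op1 a (op2 d c b) e),
    mon F (op1 a b (op1 c d e)) - mon F (op1 a b (op2 e d c)),
    mon F (op2 (op1 a b c) d e) - mon F (op2 (op2 c b a) d e),
    mon F (op1 (op2 a b c) d e) - mon F (op2 (op2 e d a) b c)
      + mon F (op2 a (op1 b e d) c) - mon F (op2 (op2 e d c) b a),
    mon F (op1 (op2 a b c) d e) - mon F (op2 a (op1 b c d) e)
      - mon F (op2 e (op1 b a d) c) + mon F (op2 (op2 a d c) b e),
    mon F (op1 (op1 a b c) d e) + mon F (op1 (op1 a b e) d c)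
      - mon F (op1 a b (op2 c d e)) - mon F (op2 c (op2 d a b) e),
    mon F (op1 (op1 a b c) d e) + mon F (op1 (op1 a d c) b e)
      - mon F (op1 a (op2 b c d) e) - mon F (op2 e (op2 b a d) c)]

end JordanDialgebra

/-!
Call the leaf of a monomial reached by following first arguments of `⟨·,·,·⟩₁` and middle arguments
of `⟨·,·,·⟩₂` its center.  In a Jordan dialgebra a product `x * y` depends on `y` only modulo the
differences `ab - ba`, so both operations are the Jordan triple product
`(ab)c + (bc)a - (ac)b`, with the center in its first and in its middle argument respectively.

*Validity.*  The symmetry and the first three identities are instances of right commutativity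
(`mul_tripleProducts`).  Each of the other four is an explicit integral combination of consequences
of the polarized axioms `osborn_linearized` and `right_jordan_linearized`; polarization requires only
that `2` is invertible.

*Completeness.*  For an associative algebra `A`, the pairs `(x, m)` of elements of `A` with product
`(x, m)(y, n) = (xy + yx, my + ym)` form a Jordan dialgebra `MarkedPair A`.  Take `A` free on unmarked
letters `aₙ` and marked letters `bₙ`.  At `xₙ = (aₙ, bₙ)` the second component of a monomial of degree
five is a sum of words, with a marked letter for the center and unmarked letters elsewhere.  If `T`
satisfies the eight identities, there is a linear map from such words to `T` that takes this sum
back to `48` times the value of the monomial in `T` (`wordMap_marked_eval`).  Therefore a polynomial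
of degree five that vanishes in `MarkedPair A` vanishes in `T`; the number `48 = 2⁴ * 3` is invertible.
The map is found as follows.  Modulo the symmetry and the first three identities, only the position
of the center in a Jordan triple monomial matters; the relations between the expansions of such
monomials are exactly those given by the remaining four identities, and solving for the words gives
`wordValue`.

*Independence.*  At a single generator `x`, the seven identities become seven linear conditions on
the ten structure constants of a graded model of dimension four (`cubicModel`).  These conditions are
linearly independent if `3 ≠ 0`, so each can be violated alone (`exists_cubicModelDefect`).
-/

namespace JordanDialgebra

/-! ### Evaluation of the eight identities -/

section Evaluation

variable {F T : Type*} [Field F] [AddCommGroup T] [Module F T]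

theorem evalPoly_eq_linearCombination (P : TernaryPair F T) (v : ℕ → T) (f : TernaryPoly F) :
    evalPoly P v f = Finsupp.linearCombination F (TernaryMonomial.eval P v) f := rfl

theorem evalPoly_add (P : TernaryPair F T) (v : ℕ → T) (f g : TernaryPoly F) :
    evalPoly P v (f + g) = evalPoly P v f + evalPoly P v g := by
  simp only [evalPoly_eq_linearCombination, map_add]

theorem evalPoly_sub (P : TernaryPair F T) (v : ℕ → T) (f g : TernaryPoly F) :
    evalPoly P v (f - g) = evalPoly P v f - evalPoly P v g := by
  simp only [evalPoly_eq_linearCombination, map_sub]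

theorem evalPoly_mon (P : TernaryPair F T) (v : ℕ → T) (m : TernaryMonomial) :
    evalPoly P v (mon F m) = m.eval P v := by
  simp [evalPoly_eq_linearCombination, mon]

/-- The left-hand side of the `i`-th of the seven identities, evaluated at `a, b, c, d, e`. -/
def degreeFiveValue (P : TernaryPair F T) (a b c d e : T) : Fin 7 → T :=
  ![P.op1 a (P.op1 b c d) e - P.op1 a (P.op2 d c b) e,
    P.op1 a b (P.op1 c d e) - P.op1 a b (P.op2 e d c),
    P.op2 (P.op1 a b c) d e - P.op2 (P.op2 c b a) d e,
    P.op1 (P.op2 a b c) d e - P.op2 (P.op2 e d a) b c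
      + P.op2 a (P.op1 b e d) c - P.op2 (P.op2 e d c) b a,
    P.op1 (P.op2 a b c) d e - P.op2 a (P.op1 b c d) e
      - P.op2 e (P.op1 b a d) c + P.op2 (P.op2 a d c) b e,
    P.op1 (P.op1 a b c) d e + P.op1 (P.op1 a b e) d c
      - P.op1 a b (P.op2 c d e) - P.op2 c (P.op2 d a b) e,
    P.op1 (P.op1 a b c) d e + P.op1 (P.op1 a d c) b e
      - P.op1 a (P.op2 b c d) e - P.op2 e (P.op2 b a d) c]

theorem evalPoly_degreeFiveIdentity (P : TernaryPair F T) (v : ℕ → T) (i : Fin 7) :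
    evalPoly P v (degreeFiveIdentity F i) =
      degreeFiveValue P (v 0) (v 1) (v 2) (v 3) (v 4) i := by
  fin_cases i <;>
  simp [degreeFiveIdentity, degreeFiveValue, evalPoly_add, evalPoly_sub, evalPoly_mon,
    TernaryMonomial.eval]

theorem satisfies_degreeFiveIdentity_iff (P : TernaryPair F T) (i : Fin 7) :
    Satisfies P (degreeFiveIdentity F i) ↔ ∀ a b c d e, degreeFiveValue P a b c d e i = 0 := by
  simp only [Satisfies, evalPoly_degreeFiveIdentity]
  exact ⟨fun h a b c d e => h fun n => [a, b, c, d, e].getD n 0, fun h v => h _ _ _ _ _⟩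

theorem satisfies_symmetryIdentity_iff (P : TernaryPair F T) :
    Satisfies P (symmetryIdentity F) ↔ ∀ a b c, P.op2 a b c = P.op2 c b a := by
  simp only [Satisfies, symmetryIdentity, evalPoly_sub, evalPoly_mon, TernaryMonomial.eval,
    sub_eq_zero]
  exact ⟨fun h a b c => h fun n => [a, b, c].getD n 0, fun h v => h _ _ _⟩

end Evaluation

/-! ### The identities hold in Jordan dialgebras -/

section Dialgebra

open IsJordanDialgebra

/-- The identity `(a,b,c²) = 2(ac,b,c)`, polarized in `c` and divided by `2`. -/
theorem osborn_linearized {F D : Type*} [Field F] (h2 : (2 : F) ≠ 0) [NonUnitalNonAssocRing D]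
    [Module F D] [IsJordanDialgebra D] (a b c d : D) :
    a * b * (c * d) - a * (b * (c * d)) =
      a * c * b * d - a * c * (b * d) + (a * d * b * c - a * d * (b * c)) := by
  have h := osborn a b (c + d)
  have hc := osborn a b c
  have hd := osborn a b d
  have e1 := right_comm (a * b) d c
  have e2 : a * (b * (d * c)) = a * (b * (c * d)) := by rw [right_comm b]
  simp only [associator_apply, mul_add, add_mul] at h hc hd
  refine smul_right_injective D h2 ?_
  simp only
  linear_combination (norm := module) h - hc - hd - e1 + e2

/-- The identity `(xa²)a = (xa)a²`, polarized completely in `a` and divided by `2`. -/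
theorem right_jordan_linearized {F D : Type*} [Field F] (h2 : (2 : F) ≠ 0)
    [NonUnitalNonAssocRing D] [Module F D] [IsJordanDialgebra D] (x a b c : D) :
    x * (a * b) * c + x * (b * c) * a + x * (c * a) * b =
      x * c * (a * b) + x * a * (b * c) + x * b * (c * a) := by
  have h := right_jordan (a + b + c) x
  have hab := right_jordan (a + b) x
  have hbc := right_jordan (b + c) x
  have hac := right_jordan (a + c) x
  have ha := right_jordan a x
  have hb := right_jordan b x
  have hc := right_jordan c x
  have e1 (y : D) := right_comm y b a
  have e2 (y : D) := right_comm y c b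
  have e3 (y : D) := right_comm y a c
  simp only [mul_add, add_mul, e1, e2, e3] at h hab hbc hac ha hb hc ⊢
  refine smul_right_injective D h2 ?_
  simp only
  linear_combination (norm := module) h - hab - hbc - hac + ha + hb + hc

theorem mul_mul_mul_swap {D : Type*} [NonUnitalNonAssocRing D] [IsJordanDialgebra D]
    (y a b c : D) : y * (a * b * c) = y * (b * a * c) := by
  rw [right_comm y, right_comm c, right_comm y]

/-- As a right factor, `⟨a,b,c⟩₁` cannot be told from `⟨c,b,a⟩₂`: the position of the center of the
right factor does not matter in a dialgebra. -/
theorem mul_tripleProducts {F D : Type*} [Field F] [NonUnitalNonAssocRing D] [Module F D]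
    [IsScalarTower F D D] [SMulCommClass F D D] [IsJordanDialgebra D] (x a b c : D) :
    x * (tripleProducts F D).op1 a b c = x * (tripleProducts F D).op2 c b a := by
  simp only [tripleProducts_op1_apply, tripleProducts_op2_apply, mul_add, mul_sub]
  rw [right_comm x a (b * c), right_comm x (a * c) b, mul_mul_mul_swap x a b c, right_comm b a c]
  abel

/-- The combination of consequences of the two polarized axioms used here comes from linear algebra
over `ℚ` on the 105 multilinear monomials with `b` leftmost, up to reordering of right factors; its
coefficients happen to be integers.  The three lemmas that follow are proved in the same way. -/
theorem tripleProducts_degreeFiveValue_three {F D : Type*} [Field F] (h2 : (2 : F) ≠ 0)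
    [NonUnitalNonAssocRing D] [Module F D] [IsScalarTower F D D] [SMulCommClass F D D]
    [IsJordanDialgebra D] (a b c d e : D) :
    degreeFiveValue (tripleProducts F D) a b c d e 3 = 0 := by
  have hO := osborn_linearized (D := D) h2
  have hJ := right_jordan_linearized (D := D) h2
  have e0 := hO b a (d * e) c
  have e1 := congrArg (b * ·) (hJ d a c e)
  have e2 := hO b e (a * c) d
  have e3 := hO b c (d * e) a
  have e4 := congrArg (b * ·) (hO c e a d)
  have e5 := hO b d (a * c) e
  have e6 := hO (b * a) d c e
  have e7 := hO (b * a) e c d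
  have e8 := hO (b * c) d a e
  have e9 := hO (b * c) e a d
  have e10 := hJ b (d * e) a c
  have e11 := congrArg (· * c) (hO b d a e)
  have e12 := congrArg (· * a) (hO b d c e)
  have e13 := congrArg (· * c) (hO b e a d)
  have e14 := congrArg (· * a) (hO b e c d)
  simp only [degreeFiveValue, Matrix.cons_val, tripleProducts_op1_apply, tripleProducts_op2_apply]
  -- Both commutation rules are permutations, which `simp` uses to sort the right factors.
  simp only [mul_add, mul_sub, add_mul, sub_mul, right_comm, mul_mul_mul_swap]
    at e0 e1 e2 e3 e4 e5 e6 e7 e8 e9 e10 e11 e12 e13 e14 ⊢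
  linear_combination (norm := module) - e0 - e1 - e2 - e3 - e4 + e5 - e6 + e7 - e8 + e9 - e10 -
    e11 - e12 + e13 + e14

theorem tripleProducts_degreeFiveValue_four {F D : Type*} [Field F] (h2 : (2 : F) ≠ 0)
    [NonUnitalNonAssocRing D] [Module F D] [IsScalarTower F D D] [SMulCommClass F D D]
    [IsJordanDialgebra D] (a b c d e : D) :
    degreeFiveValue (tripleProducts F D) a b c d e 4 = 0 := by
  have hO := osborn_linearized (D := D) h2
  have hJ := right_jordan_linearized (D := D) h2
  have e0 := hO (b * a) e c d
  have e1 := hO (b * d) e a c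
  have e2 := hO b e (a * c) d
  have e3 := hO (b * c) e a d
  have e4 := hO b e (a * d) c
  have e5 := congrArg (· * e) (hO b a c d)
  have e6 := congrArg (· * e) (hO b c a d)
  have e7 := congrArg (· * e) (hO b d a c)
  have e8 := congrArg (· * e) (hJ b a c d)
  have e9 := hO b e (c * d) a
  simp only [degreeFiveValue, Matrix.cons_val, tripleProducts_op1_apply, tripleProducts_op2_apply]
  simp only [mul_add, mul_sub, add_mul, sub_mul, right_comm]
    at e0 e1 e2 e3 e4 e5 e6 e7 e8 e9 ⊢
  linear_combination (norm := module) e0 - e1 - e2 + e3 + e4 - e5 - e6 + e7 - e8 + e9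

theorem tripleProducts_degreeFiveValue_five {F D : Type*} [Field F] (h2 : (2 : F) ≠ 0)
    [NonUnitalNonAssocRing D] [Module F D] [IsScalarTower F D D] [SMulCommClass F D D]
    [IsJordanDialgebra D] (a b c d e : D) :
    degreeFiveValue (tripleProducts F D) a b c d e 5 = 0 := by
  have hO := osborn_linearized (D := D) h2
  have hJ := right_jordan_linearized (D := D) h2
  have e0 := hO a b (d * e) c
  have e1 := hO (a * b) c d e
  have e2 := hO a b (c * e) d
  have e3 := hO (a * b) d c e
  have e4 := hO a b (c * d) e
  have e5 := hO (a * b) e c d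
  have e6 := congrArg (· * c) (hJ a b d e)
  have e7 := congrArg (· * e) (hJ a b c d)
  have e8 := hJ a (d * e) b c
  have e9 := congrArg (· * c) (hO a b d e)
  have e10 := hJ a (c * e) b d
  have e11 := congrArg (· * d) (hO a b c e)
  have e12 := hJ a (c * d) b e
  have e13 := congrArg (· * e) (hO a b c d)
  have e14 := congrArg (· * d) (hJ a b c e)
  simp only [degreeFiveValue, Matrix.cons_val, tripleProducts_op1_apply, tripleProducts_op2_apply]
  simp only [mul_add, mul_sub, add_mul, sub_mul, right_comm]
    at e0 e1 e2 e3 e4 e5 e6 e7 e8 e9 e10 e11 e12 e13 e14 ⊢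
  linear_combination (norm := module) e0 + e1 - e2 - e3 + e4 + e5 + e6 + e7 + e8 + e9 - e10 - e11
    + e12 + e13 - e14

theorem tripleProducts_degreeFiveValue_six {F D : Type*} [Field F] (h2 : (2 : F) ≠ 0)
    [NonUnitalNonAssocRing D] [Module F D] [IsScalarTower F D D] [SMulCommClass F D D]
    [IsJordanDialgebra D] (a b c d e : D) :
    degreeFiveValue (tripleProducts F D) a b c d e 6 = 0 := by
  have hO := osborn_linearized (D := D) h2
  have hJ := right_jordan_linearized (D := D) h2
  have e0 := hO a e (c * d) b
  have e1 := hO (a * b) e c d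
  have e2 := hO a e (b * d) c
  have e3 := hO a e (b * c) d
  have e4 := hO (a * c) e b d
  have e5 := hO (a * d) e b c
  have e6 := congrArg (· * e) (hJ a b c d)
  have e7 := congrArg (· * e) (hO a b c d)
  have e8 := congrArg (· * e) (hO a c b d)
  have e9 := congrArg (· * e) (hO a d b c)
  simp only [degreeFiveValue, Matrix.cons_val, tripleProducts_op1_apply, tripleProducts_op2_apply]
  simp only [mul_add, mul_sub, add_mul, sub_mul, right_comm]
    at e0 e1 e2 e3 e4 e5 e6 e7 e8 e9 ⊢
  linear_combination (norm := module) e0 + e1 - e2 + e3 - e4 + e5 + e6 + e7 - e8 + e9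

theorem tripleProducts_op2_symm (F : Type*) {D : Type*} [Field F] [NonUnitalNonAssocRing D]
    [Module F D] [IsScalarTower F D D] [SMulCommClass F D D] [IsJordanDialgebra D] (a b c : D) :
    (tripleProducts F D).op2 a b c = (tripleProducts F D).op2 c b a := by
  simp only [tripleProducts_op2_apply, right_comm b a c]
  abel

theorem tripleProducts_degreeFiveValue {F D : Type*} [Field F] (h2 : (2 : F) ≠ 0)
    [NonUnitalNonAssocRing D] [Module F D] [IsScalarTower F D D] [SMulCommClass F D D]
    [IsJordanDialgebra D] (a b c d e : D) (i : Fin 7) :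
    degreeFiveValue (tripleProducts F D) a b c d e i = 0 := by
  fin_cases i
  · have h (x : D) := mul_tripleProducts (F := F) x b c d
    simp only [degreeFiveValue, Fin.zero_eta, Matrix.cons_val, sub_eq_zero]
    rw [tripleProducts_op1_apply F a, tripleProducts_op1_apply F a, h a, h (a * e),
      right_comm a _ e, h e, right_comm a e]
  · have h (x : D) := mul_tripleProducts (F := F) x c d e
    simp only [degreeFiveValue, Fin.mk_one, Matrix.cons_val, sub_eq_zero]
    rw [tripleProducts_op1_apply F a b, tripleProducts_op1_apply F a b, h (a * b), h a, h b]
  · have h (x : D) := mul_tripleProducts (F := F) x a b c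
    simp only [degreeFiveValue, Fin.reduceFinMk, Matrix.cons_val, sub_eq_zero]
    rw [tripleProducts_op2_apply F _ d e, tripleProducts_op2_apply F _ d e, h d, h (d * e),
      right_comm d _ e, h e, right_comm d e]
  · exact tripleProducts_degreeFiveValue_three h2 a b c d e
  · exact tripleProducts_degreeFiveValue_four h2 a b c d e
  · exact tripleProducts_degreeFiveValue_five h2 a b c d e
  · exact tripleProducts_degreeFiveValue_six h2 a b c d e

end Dialgebra

/-! ### Independence -/

section Independence

/-- A graded model with one generator: coordinate `0` is the generator `x` in degree 1, coordinates
`1` and `2` are `⟨x,x,x⟩₁` and `⟨x,x,x⟩₂` in degree 3, and coordinate `3` is the only element of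
degree 5.  The parameters are the degree 5 products of two copies of `x` and one of the two elements
of degree 3: `p`, `q`, `r` for this element in the first, second, third argument of the first
operation, `s` for it in the first or third and `t` for it in the second argument of the second
operation. -/
def cubicModel {F : Type*} [Field F] (p q r s t : Fin 2 → F) : TernaryPair F (Fin 4 → F) where
  op1 := mkTrilinear (fun a b c => ![0, a 0 * b 0 * c 0, 0,
      (p 0 * a 1 + p 1 * a 2) * b 0 * c 0 + a 0 * (q 0 * b 1 + q 1 * b 2) * c 0
        + a 0 * b 0 * (r 0 * c 1 + r 1 * c 2)])
    (by intros; ext i; fin_cases i <;> simp <;> ring)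
    (by intros; ext i; fin_cases i <;> simp <;> ring)
    (by intros; ext i; fin_cases i <;> simp <;> ring)
    (by intros; ext i; fin_cases i <;> simp <;> ring)
    (by intros; ext i; fin_cases i <;> simp <;> ring)
    (by intros; ext i; fin_cases i <;> simp <;> ring)
  op2 := mkTrilinear (fun a b c => ![0, 0, a 0 * b 0 * c 0,
      (s 0 * a 1 + s 1 * a 2) * b 0 * c 0 + a 0 * (t 0 * b 1 + t 1 * b 2) * c 0
        + a 0 * b 0 * (s 0 * c 1 + s 1 * c 2)])
    (by intros; ext i; fin_cases i <;> simp <;> ring)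
    (by intros; ext i; fin_cases i <;> simp <;> ring)
    (by intros; ext i; fin_cases i <;> simp <;> ring)
    (by intros; ext i; fin_cases i <;> simp <;> ring)
    (by intros; ext i; fin_cases i <;> simp <;> ring)
    (by intros; ext i; fin_cases i <;> simp <;> ring)

theorem cubicModel_op1_apply {F : Type*} [Field F] (p q r s t : Fin 2 → F) (a b c : Fin 4 → F) :
    (cubicModel p q r s t).op1 a b c 0 = 0 ∧
    (cubicModel p q r s t).op1 a b c 1 = a 0 * b 0 * c 0 ∧
    (cubicModel p q r s t).op1 a b c 2 = 0 ∧
    (cubicModel p q r s t).op1 a b c 3 =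
      (p 0 * a 1 + p 1 * a 2) * b 0 * c 0 + a 0 * (q 0 * b 1 + q 1 * b 2) * c 0
        + a 0 * b 0 * (r 0 * c 1 + r 1 * c 2) :=
  ⟨rfl, rfl, rfl, rfl⟩

theorem cubicModel_op2_apply {F : Type*} [Field F] (p q r s t : Fin 2 → F) (a b c : Fin 4 → F) :
    (cubicModel p q r s t).op2 a b c 0 = 0 ∧
    (cubicModel p q r s t).op2 a b c 1 = 0 ∧
    (cubicModel p q r s t).op2 a b c 2 = a 0 * b 0 * c 0 ∧
    (cubicModel p q r s t).op2 a b c 3 =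
      (s 0 * a 1 + s 1 * a 2) * b 0 * c 0 + a 0 * (t 0 * b 1 + t 1 * b 2) * c 0
        + a 0 * b 0 * (s 0 * c 1 + s 1 * c 2) :=
  ⟨rfl, rfl, rfl, rfl⟩

theorem cubicModel_symmetry {F : Type*} [Field F] (p q r s t : Fin 2 → F) (a b c : Fin 4 → F) :
    (cubicModel p q r s t).op2 a b c = (cubicModel p q r s t).op2 c b a := by
  ext n
  fin_cases n <;> simp [cubicModel_op2_apply] <;> ring

/-- The values at `x, x, x, x, x` of the seven identities in `cubicModel`, as linear forms in the
parameters of the model. -/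
def cubicModelDefect {F : Type*} [Field F] (p q r s t : Fin 2 → F) : Fin 7 → F :=
  ![q 0 - q 1, r 0 - r 1, s 0 - s 1, p 1 - 2 * s 1 + t 0, p 1 + s 1 - 2 * t 0,
    2 * p 0 - r 1 - t 1, 2 * p 0 - q 1 - t 1]

theorem degreeFiveValue_cubicModel {F : Type*} [Field F] (p q r s t : Fin 2 → F)
    (a b c d e : Fin 4 → F) (j : Fin 7) :
    degreeFiveValue (cubicModel p q r s t) a b c d e j =
      ![0, 0, 0, a 0 * b 0 * c 0 * d 0 * e 0 * cubicModelDefect p q r s t j] := by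
  ext n
  fin_cases n
  · fin_cases j <;> simp [degreeFiveValue, cubicModel_op1_apply, cubicModel_op2_apply]
  · fin_cases j <;> simp [degreeFiveValue, cubicModel_op1_apply, cubicModel_op2_apply]
  · fin_cases j <;> simp [degreeFiveValue, cubicModel_op1_apply, cubicModel_op2_apply]
  · fin_cases j <;>
    simp [degreeFiveValue, cubicModelDefect, cubicModel_op1_apply, cubicModel_op2_apply] <;> ring

/-- The seven linear forms `cubicModelDefect` are linearly independent when `3 ≠ 0`; this is where
the independence of the identities comes from. -/
theorem exists_cubicModelDefect {F : Type*} [Field F] (h3 : (3 : F) ≠ 0) (i : Fin 7) :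
    ∃ p q r s t : Fin 2 → F, cubicModelDefect p q r s t i ≠ 0 ∧
      ∀ j, j ≠ i → cubicModelDefect p q r s t j = 0 := by
  fin_cases i
  · exact ⟨0, ![1, 0], 0, 0, 0, by simp [cubicModelDefect],
      fun j hj => by fin_cases j <;> simp [cubicModelDefect] at hj ⊢⟩
  · exact ⟨0, 0, ![1, 0], 0, 0, by simp [cubicModelDefect],
      fun j hj => by fin_cases j <;> simp [cubicModelDefect] at hj ⊢⟩
  · exact ⟨0, 0, 0, ![1, 0], 0, by simp [cubicModelDefect],
      fun j hj => by fin_cases j <;> simp [cubicModelDefect] at hj ⊢⟩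
  · refine ⟨![0, 1], 0, 0, ![-1, -1], 0, ?_,
      fun j hj => by fin_cases j <;> simp [cubicModelDefect] at hj ⊢⟩
    convert h3 using 1
    simp [cubicModelDefect]; norm_num
  · refine ⟨![0, 1], 0, 0, 0, ![-1, 0], ?_,
      fun j hj => by fin_cases j <;> simp [cubicModelDefect] at hj ⊢⟩
    convert h3 using 1
    simp [cubicModelDefect]; norm_num
  · exact ⟨0, 0, ![1, 1], 0, 0, by simp [cubicModelDefect],
      fun j hj => by fin_cases j <;> simp [cubicModelDefect] at hj ⊢⟩
  · exact ⟨0, ![1, 1], 0, 0, 0, by simp [cubicModelDefect],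
      fun j hj => by fin_cases j <;> simp [cubicModelDefect] at hj ⊢⟩

theorem not_isConsequence_degreeFiveIdentity {F : Type u} [Field F] (h3 : (3 : F) ≠ 0)
    (i : Fin 7) :
    ¬ IsConsequence (insert (symmetryIdentity F) (degreeFiveIdentity F '' {j | j ≠ i}))
      (degreeFiveIdentity F i) := by
  obtain ⟨p, q, r, s, t, hi, hj⟩ := exists_cubicModelDefect h3 i
  intro h
  have key := h (Fin 4 → F) (cubicModel p q r s t) ?_
  · rw [satisfies_degreeFiveIdentity_iff] at key
    have := congrFun (key ![1, 0, 0, 0] ![1, 0, 0, 0] ![1, 0, 0, 0] ![1, 0, 0, 0] ![1, 0, 0, 0]) 3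
    rw [degreeFiveValue_cubicModel] at this
    exact hi (by simpa using this)
  · rintro g (rfl | ⟨j, hji, rfl⟩)
    · exact (satisfies_symmetryIdentity_iff _).2 (cubicModel_symmetry p q r s t)
    · rw [satisfies_degreeFiveIdentity_iff]
      intro a b c d e
      rw [degreeFiveValue_cubicModel, hj j hji]
      ext n; fin_cases n <;> simp

end Independence

/-! ### A Jordan dialgebra that records the center of a monomial -/

section MarkedPairs

/-- Pairs of elements of an associative ring `A` with the product
`(x, m)(y, n) = (xy + yx, my + ym)`, a Jordan dialgebra.  The marked component of a product depends
linearly on that of the left factor and involves only the plain component of the right factor.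
The usual factor `1/2` of the Jordan product is omitted. -/
@[ext]
structure MarkedPair (A : Type*) where
  plain : A
  marked : A

namespace MarkedPair

/-- The underlying pair, through which the additive group and module structures are defined. -/
def equivProd (A : Type*) : MarkedPair A ≃ A × A where
  toFun x := (x.plain, x.marked)
  invFun x := ⟨x.1, x.2⟩

variable {A : Type*} [Ring A]

instance : AddCommGroup (MarkedPair A) := (equivProd A).addCommGroup

instance : Mul (MarkedPair A) :=
  ⟨fun x y => ⟨x.plain * y.plain + y.plain * x.plain, x.marked * y.plain + y.plain * x.marked⟩⟩

theorem plain_add (x y : MarkedPair A) : (x + y).plain = x.plain + y.plain := rfl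
theorem marked_add (x y : MarkedPair A) : (x + y).marked = x.marked + y.marked := rfl
theorem plain_sub (x y : MarkedPair A) : (x - y).plain = x.plain - y.plain := rfl
theorem marked_sub (x y : MarkedPair A) : (x - y).marked = x.marked - y.marked := rfl
theorem plain_zero : (0 : MarkedPair A).plain = 0 := rfl
theorem marked_zero : (0 : MarkedPair A).marked = 0 := rfl
theorem plain_mul (x y : MarkedPair A) : (x * y).plain = x.plain * y.plain + y.plain * x.plain :=
  rfl

theorem marked_mul (x y : MarkedPair A) : (x * y).marked = x.marked * y.plain + y.plain * x.marked :=
  rfl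

instance : NonUnitalNonAssocRing (MarkedPair A) where
  left_distrib x y z := by
    apply MarkedPair.ext <;> simp only [plain_add, marked_add, plain_mul, marked_mul] <;>
    noncomm_ring
  right_distrib x y z := by
    apply MarkedPair.ext <;> simp only [plain_add, marked_add, plain_mul, marked_mul] <;>
    noncomm_ring
  zero_mul x := by
    apply MarkedPair.ext <;> simp [plain_mul, marked_mul, plain_zero, marked_zero]
  mul_zero x := by
    apply MarkedPair.ext <;> simp [plain_mul, marked_mul, plain_zero, marked_zero]

instance : IsJordanDialgebra (MarkedPair A) where
  right_comm a b c := by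
    apply MarkedPair.ext <;> simp only [plain_mul, marked_mul] <;> noncomm_ring
  osborn a b c := by
    apply MarkedPair.ext <;>
    simp only [associator_apply, two_nsmul, plain_add, marked_add, plain_sub, marked_sub, plain_mul,
      marked_mul] <;> noncomm_ring
  right_jordan a b := by
    apply MarkedPair.ext <;> simp only [plain_mul, marked_mul] <;> noncomm_ring

variable {F : Type*} [Field F] [Algebra F A]

instance : Module F (MarkedPair A) := (equivProd A).module F

theorem plain_smul (r : F) (x : MarkedPair A) : (r • x).plain = r • x.plain := rfl
theorem marked_smul (r : F) (x : MarkedPair A) : (r • x).marked = r • x.marked := rfl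

instance : IsScalarTower F (MarkedPair A) (MarkedPair A) where
  smul_assoc r x y := by
    apply MarkedPair.ext <;>
    simp only [smul_eq_mul, plain_mul, marked_mul, plain_smul, marked_smul, smul_add,
      smul_mul_assoc, mul_smul_comm]

instance : SMulCommClass F (MarkedPair A) (MarkedPair A) where
  smul_comm r x y := by
    apply MarkedPair.ext <;>
    simp only [smul_eq_mul, plain_mul, marked_mul, plain_smul, marked_smul, smul_add,
      smul_mul_assoc, mul_smul_comm]

/-- The marked component, as a linear map. -/
def markedLinearMap (F A : Type*) [Field F] [Ring A] [Algebra F A] : MarkedPair A →ₗ[F] A where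
  toFun := marked
  map_add' := marked_add
  map_smul' := marked_smul

theorem plain_op1 (a b c : MarkedPair A) :
    ((tripleProducts F (MarkedPair A)).op1 a b c).plain =
      (2 : F) • (a.plain * b.plain * c.plain + c.plain * b.plain * a.plain) := by
  rw [tripleProducts_op1_apply, two_smul]
  simp only [plain_add, plain_sub, plain_mul]
  noncomm_ring

theorem marked_op1 (a b c : MarkedPair A) :
    ((tripleProducts F (MarkedPair A)).op1 a b c).marked =
      (2 : F) • (a.marked * b.plain * c.plain + c.plain * b.plain * a.marked) := by
  rw [tripleProducts_op1_apply, two_smul]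
  simp only [marked_add, marked_sub, plain_mul, marked_mul]
  noncomm_ring

theorem plain_op2 (a b c : MarkedPair A) :
    ((tripleProducts F (MarkedPair A)).op2 a b c).plain =
      (2 : F) • (a.plain * b.plain * c.plain + c.plain * b.plain * a.plain) := by
  rw [tripleProducts_op2_apply, two_smul]
  simp only [plain_add, plain_sub, plain_mul]
  noncomm_ring

theorem marked_op2 (a b c : MarkedPair A) :
    ((tripleProducts F (MarkedPair A)).op2 a b c).marked =
      (2 : F) • (a.plain * b.marked * c.plain + c.plain * b.marked * a.plain) := by
  rw [tripleProducts_op2_apply, two_smul]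
  simp only [marked_add, marked_sub, plain_mul, marked_mul]
  noncomm_ring

end MarkedPair

end MarkedPairs

/-! ### Monomials of degree five -/

section Monomials

namespace TernaryMonomial

theorem degree_pos (m : TernaryMonomial) : 0 < m.degree := by
  induction m <;> simp only [degree] <;> omega

theorem degree_mod_two (m : TernaryMonomial) : m.degree % 2 = 1 := by
  induction m <;> simp only [degree] <;> omega

theorem exists_eq_var_of_degree_eq_one {m : TernaryMonomial} (h : m.degree = 1) :
    ∃ n, m = var n := by
  cases m with
  | var n => exact ⟨n, rfl⟩
  | op1 s t u | op2 s t u =>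
    have := s.degree_pos; have := t.degree_pos; have := u.degree_pos
    simp only [degree] at h
    omega

theorem exists_eq_of_degree_eq_three {m : TernaryMonomial} (h : m.degree = 3) :
    ∃ i j k, m = op1 (var i) (var j) (var k) ∨ m = op2 (var i) (var j) (var k) := by
  cases m with
  | var n => simp [degree] at h
  | op1 s t u | op2 s t u =>
    have := s.degree_pos; have := t.degree_pos; have := u.degree_pos
    simp only [degree] at h
    obtain ⟨i, rfl⟩ := exists_eq_var_of_degree_eq_one (m := s) (by omega)
    obtain ⟨j, rfl⟩ := exists_eq_var_of_degree_eq_one (m := t) (by omega)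
    obtain ⟨k, rfl⟩ := exists_eq_var_of_degree_eq_one (m := u) (by omega)
    exact ⟨i, j, k, by simp⟩

theorem exists_eq_of_degree_eq_five {m : TernaryMonomial} (h : m.degree = 5) :
    ∃ s t u : TernaryMonomial, (m = op1 s t u ∨ m = op2 s t u) ∧
      ((s.degree = 3 ∧ t.degree = 1 ∧ u.degree = 1) ∨
      (s.degree = 1 ∧ t.degree = 3 ∧ u.degree = 1) ∨
      (s.degree = 1 ∧ t.degree = 1 ∧ u.degree = 3)) := by
  cases m with
  | var n => simp [degree] at h
  | op1 s t u | op2 s t u =>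
    have := s.degree_pos; have := t.degree_pos; have := u.degree_pos
    have := s.degree_mod_two; have := t.degree_mod_two; have := u.degree_mod_two
    simp only [degree] at h
    exact ⟨s, t, u, by simp, by omega⟩

end TernaryMonomial

end Monomials

/-! ### Recovering a monomial from its expansion into associative words -/

section Retraction

/-- The free associative algebra on two families of letters indexed by `ℕ`: marked ones
`(true, n)` and unmarked ones `(false, n)`. -/
abbrev MarkedWords (F : Type*) [Field F] : Type _ := MonoidAlgebra F (FreeMonoid (Bool × ℕ))

/-- A letter as an element of the free associative algebra. -/
noncomputable def letter (F : Type*) [Field F] (l : Bool × ℕ) : MarkedWords F :=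
  MonoidAlgebra.of F _ (FreeMonoid.of l)

variable {F T : Type*} [Field F] [AddCommGroup T] [Module F T]

/-- The element of `T` assigned to an associative word of length five with exactly one marked
letter.
Triple products expand into sums of words `w` plus their reversals, so it suffices to use the words
with the mark in one of the first three positions; all others are sent to `0`.  The coefficients
solve the linear equations expressing `wordMap_marked_eval`; these equations never mix odd with even
positions of the mark.  They are scaled by `12` to be integers. -/
def wordValue (P : TernaryPair F T) (v : ℕ → T) : List (Bool × ℕ) → T
  | [(true, m), (false, b), (false, c), (false, d), (false, e)] =>
    (6 : F) • (P.op1 (P.op1 (v m) (v b) (v c)) (v d) (v e)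
      - P.op1 (P.op1 (v m) (v d) (v c)) (v b) (v e)
      + P.op1 (v m) (P.op2 (v b) (v c) (v d)) (v e))
  | [(false, p), (true, m), (false, q), (false, d), (false, r)] =>
    (6 : F) • P.op2 (P.op2 (v q) (v d) (v r)) (v m) (v p)
      + (2 : F) • (P.op2 (P.op2 (v p) (v d) (v r)) (v m) (v q)
        - P.op2 (P.op2 (v p) (v d) (v q)) (v m) (v r))
      + (4 : F) • (P.op2 (v p) (P.op1 (v m) (v q) (v d)) (v r)
        - P.op2 (v p) (P.op1 (v m) (v r) (v d)) (v q))
  | [(false, b), (false, c), (true, m), (false, d), (false, e)] =>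
    (3 : F) • P.op2 (v b) (P.op2 (v c) (v m) (v d)) (v e)
  | _ => 0

/-- The linear extension of `wordValue`. -/
noncomputable def wordMap (P : TernaryPair F T) (v : ℕ → T) : MarkedWords F →ₗ[F] T :=
  Finsupp.linearCombination F (fun w => wordValue P v w.toList) ∘ₗ
    (MonoidAlgebra.coeffLinearEquiv F).toLinearMap

theorem wordMap_letters (P : TernaryPair F T) (v : ℕ → T) (p q r s t : Bool × ℕ) :
    wordMap P v (letter F p * letter F q * letter F r * letter F s * letter F t) =
      wordValue P v [p, q, r, s, t] := by
  simp only [letter, ← map_mul]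
  simp [wordMap]

/-- The point at which the variable `xₙ` is the unmarked letter `n`, with the marked letter `n` as
its marked component. -/
noncomputable def genericPoint (F : Type*) [Field F] (n : ℕ) : MarkedPair (MarkedWords F) :=
  ⟨letter F (false, n), letter F (true, n)⟩

/-- If `P` satisfies the eight identities, a monomial `m` of degree five can be recovered from its
expansion at the generic point.  The factor is `48 = 2 * 2 * 12`: a factor `2` for each of the two
triple products, and `12` from `wordValue`. -/
theorem wordMap_marked_eval (P : TernaryPair F T) (v : ℕ → T)
    (hs : ∀ a b c, P.op2 a b c = P.op2 c b a)
    (hi : ∀ i a b c d e, degreeFiveValue P a b c d e i = 0)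
    {m : TernaryMonomial} (hm : m.degree = 5) :
    wordMap P v (m.eval (tripleProducts F _) (genericPoint F)).marked = (48 : F) • m.eval P v := by
  -- Inside an argument without the center, the two operations and both orders of the outer
  -- entries agree.
  have n1 (a b c d e) : P.op1 a (P.op1 b c d) e = P.op1 a (P.op2 b c d) e := by
    rw [hs b]; exact sub_eq_zero.1 (hi 0 a b c d e)
  have n2 (a b c d e) : P.op1 a b (P.op1 c d e) = P.op1 a b (P.op2 c d e) := by
    rw [hs c]; exact sub_eq_zero.1 (hi 1 a b c d e)
  have n3 (a b c d e) : P.op2 (P.op1 a b c) d e = P.op2 (P.op2 a b c) d e := by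
    rw [hs a]; exact sub_eq_zero.1 (hi 2 a b c d e)
  have n4 (a b c d e) : P.op2 a b (P.op1 c d e) = P.op2 a b (P.op2 c d e) := by
    rw [hs, n3, hs]
  have r4 := hi 3
  have r5 := hi 4
  have r6 := hi 5
  have r7 := hi 6
  simp only [degreeFiveValue, Matrix.cons_val] at r4 r5 r6 r7
  obtain ⟨s, t, u, hm, ⟨d1, d2, d3⟩ | ⟨d1, d2, d3⟩ | ⟨d1, d2, d3⟩⟩ :=
    TernaryMonomial.exists_eq_of_degree_eq_five hm
  · obtain ⟨i, j, k, hx⟩ := TernaryMonomial.exists_eq_of_degree_eq_three d1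
    obtain ⟨n, rfl⟩ := TernaryMonomial.exists_eq_var_of_degree_eq_one d2
    obtain ⟨l, rfl⟩ := TernaryMonomial.exists_eq_var_of_degree_eq_one d3
    rcases hm with rfl | rfl <;> rcases hx with rfl | rfl <;>
    simp only [TernaryMonomial.eval, MarkedPair.plain_op1, MarkedPair.marked_op1,
      MarkedPair.plain_op2, MarkedPair.marked_op2, genericPoint, mul_add, add_mul, smul_add,
      smul_mul_assoc, mul_smul_comm, ← mul_assoc, map_add, map_smul, wordMap_letters, wordValue]
    · have h := r7 (v i) (v j) (v k) (v n) (v l)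
      -- `hs` is a permutation: here and below `simp` uses it to sort the arguments of `op2`.
      simp only [hs] at h ⊢
      linear_combination (norm := module) (-24 : F) • h
    · have h := r4 (v i) (v j) (v k) (v n) (v l)
      have h' := r5 (v i) (v j) (v k) (v n) (v l)
      simp only [hs] at h h' ⊢
      linear_combination (norm := module) (-32 : F) • h + (-16 : F) • h'
    · simp only [n3, hs]
      module
    · simp only [hs]
      module
  · obtain ⟨n, rfl⟩ := TernaryMonomial.exists_eq_var_of_degree_eq_one d1
    obtain ⟨i, j, k, hx⟩ := TernaryMonomial.exists_eq_of_degree_eq_three d2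
    obtain ⟨l, rfl⟩ := TernaryMonomial.exists_eq_var_of_degree_eq_one d3
    rcases hm with rfl | rfl <;> rcases hx with rfl | rfl <;>
    simp only [TernaryMonomial.eval, MarkedPair.plain_op1, MarkedPair.marked_op1,
      MarkedPair.plain_op2, MarkedPair.marked_op2, genericPoint, mul_add, add_mul, smul_add,
      smul_mul_assoc, mul_smul_comm, ← mul_assoc, map_add, map_smul, wordMap_letters, wordValue]
    · simp only [n1, hs]
      module
    · simp only [hs]
      module
    · have h := r4 (v n) (v i) (v j) (v k) (v l)
      have h' := r5 (v n) (v i) (v j) (v k) (v l)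
      simp only [hs] at h h' ⊢
      linear_combination (norm := module) (16 : F) • h' - (16 : F) • h
    · simp only [hs]
      module
  · obtain ⟨n, rfl⟩ := TernaryMonomial.exists_eq_var_of_degree_eq_one d1
    obtain ⟨l, rfl⟩ := TernaryMonomial.exists_eq_var_of_degree_eq_one d2
    obtain ⟨i, j, k, hx⟩ := TernaryMonomial.exists_eq_of_degree_eq_three d3
    have h := r6 (v n) (v l) (v i) (v j) (v k)
    have h' := r7 (v n) (v l) (v i) (v j) (v k)
    have h'' := r7 (v n) (v l) (v k) (v j) (v i)
    rcases hm with rfl | rfl <;> rcases hx with rfl | rfl <;>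
    simp only [TernaryMonomial.eval, MarkedPair.plain_op1, MarkedPair.marked_op1,
      MarkedPair.plain_op2, MarkedPair.marked_op2, genericPoint, mul_add, add_mul, smul_add,
      smul_mul_assoc, mul_smul_comm, ← mul_assoc, map_add, map_smul, wordMap_letters, wordValue]
    · simp only [n2, hs] at h h' h'' ⊢
      linear_combination (norm := module) (48 : F) • h - (24 : F) • h' - (24 : F) • h''
    · simp only [hs] at h h' h'' ⊢
      linear_combination (norm := module) (48 : F) • h - (24 : F) • h' - (24 : F) • h''
    · simp only [n4, hs]
      module
    · simp only [hs]
      module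

end Retraction

/-! ### Completeness -/

section Completeness

/-- No linearization of `f` is needed: the generic point separates the center from the other letters
even when variables are repeated, so small positive characteristics cause no trouble. -/
theorem satisfies_of_isJordanDialgebraIdentity {F : Type u} {T : Type*} [Field F] [AddCommGroup T]
    [Module F T] (h2 : (2 : F) ≠ 0) (h3 : (3 : F) ≠ 0) {f : TernaryPoly F} (hf : IsHomogeneous f 5)
    (hD : IsJordanDialgebraIdentity f) (P : TernaryPair F T)
    (hs : ∀ a b c, P.op2 a b c = P.op2 c b a)
    (hi : ∀ i a b c d e, degreeFiveValue P a b c d e i = 0) : Satisfies P f := by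
  intro v
  have h48 : (48 : F) ≠ 0 := by
    have : (48 : F) = 2 ^ 4 * 3 := by norm_num
    rw [this]
    exact mul_ne_zero (pow_ne_zero 4 h2) h3
  have h : wordMap P v (MarkedPair.markedLinearMap F _
      (evalPoly (tripleProducts F _) (genericPoint F) f)) = (48 : F) • evalPoly P v f := by
    simp only [evalPoly, Finsupp.sum, map_sum, map_smul, Finset.smul_sum]
    refine Finset.sum_congr rfl fun m hm => ?_
    rw [smul_comm, ← wordMap_marked_eval P v hs hi (hf m hm)]
    rfl
  rw [hD _ (genericPoint F), map_zero, map_zero] at h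
  exact (smul_eq_zero.1 h.symm).resolve_left h48

end Completeness
end JordanDialgebra

open JordanDialgebra in
theorem theorem6p2 {F : Type u} [Field F] (h2 : (2 : F) ≠ 0) (h3 : (3 : F) ≠ 0) :
    -- the eight identities hold in every Jordan dialgebra
    IsJordanDialgebraIdentity (symmetryIdentity F) ∧
    (∀ i, IsJordanDialgebraIdentity (degreeFiveIdentity F i)) ∧
    -- every identity of degree 5 is a consequence of them
    (∀ f : TernaryPoly F, IsHomogeneous f 5 → IsJordanDialgebraIdentity f →
      IsConsequence (insert (symmetryIdentity F) (Set.range (degreeFiveIdentity F))) f) ∧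
    -- modulo the symmetry, none of the seven is a consequence of the other six
    (∀ i, ¬ IsConsequence (insert (symmetryIdentity F) (degreeFiveIdentity F '' {j | j ≠ i}))
      (degreeFiveIdentity F i)) := by
  refine ⟨?_, ?_, ?_, not_isConsequence_degreeFiveIdentity h3⟩
  · intro D _ _ _ _ _
    exact (satisfies_symmetryIdentity_iff _).2 (tripleProducts_op2_symm F)
  · intro i D _ _ _ _ _
    exact (satisfies_degreeFiveIdentity_iff _ i).2 fun a b c d e =>
      tripleProducts_degreeFiveValue h2 a b c d e i
  · intro f hf hD T _ _ P hP
    refine satisfies_of_isJordanDialgebraIdentity h2 h3 hf hD P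
      ((satisfies_symmetryIdentity_iff P).1 (hP _ (Set.mem_insert _ _))) fun i => ?_
    exact (satisfies_degreeFiveIdentity_iff P i).1 (hP _ (Set.mem_insert_of_mem _ ⟨i, rfl⟩))
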